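/- Let $\Sigma$ be a set of program states. An (Aczel) trace is an initial state $\sigma_0\in\Sigma$ followed by a finite or infinite sequence of steps, each step being a program ($\pi$) or an environment ($\epsilon$) transition to a next state; a finite trace is moreover marked as terminated, aborted or incomplete. A command is a set of traces that contains the incomplete trace without steps from every state, contains with every trace all its finite prefixes marked incomplete, and contains with every aborted trace all traces that extend it. Commands form a complete lattice under inclusion: $c\succeq d$ ($c$ is refined by $d$) means $d\subseteq c$, nondeterministic choice $\bigvee C$, $c\vee d$ is the join, and the greatest command is $\lightning$ (abort). Further operators on commands are as follows; each set of traces described is closed up to the least command containing it. - Test $\tau_p$ ($p\subseteq\Sigma$): the terminated traces without steps from states in $p$; $\boldsymbol\tau=\tau_\Sigma$. Assertion: $\{p\}=\boldsymbol\tau\vee\tau_{\Sigma\setminus p};\lightning$. - Atomic step $\alpha(r)$ ($r\subseteq\Sigma\times\Sigma$): the terminated traces with one step, of either kind, from $\sigma_0$ to $\sigma$ with $(\sigma_0,\sigma)\in r$. - Sequential composition $c;d$: the traces of $c$ that are not terminated, and the concatenations of a terminated trace of $c$ with a trace of $d$ starting in its final state. - Weak conjunction $c\Cap d$: the traces common to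 $c$ and $d$, and the aborted traces that belong to one of $c,d$ and whose incomplete version belongs to the other. - Parallel composition $c\parallel d$: the step-by-step synchronisations of a trace of $c$ and a trace of $d$ with the same states and the same number of steps, where $\pi$ and $\epsilon$ combine to $\pi$ (in either order), $\epsilon$ and $\epsilon$ to $\epsilon$, and $\pi$ and $\pi$ do not combine; both traces are terminated, or both incomplete, or both infinite, and the result is likewise; or one is aborted and the other incomplete, and the result is aborted. - Finite iteration $c^{\star}$ and possibly infinite iteration $c^{\omega}$: the least and the greatest fixed point, respectively, of $y\mapsto\boldsymbol\tau\vee c;y$. For $I\subseteq\Sigma$ let $\operatorname{inv} I=\{I\};\bigl(\alpha(\{(\sigma_0,\sigma)\mid\sigma\in I\})\bigr)^{\omega}$, and say that $d$ is a data reification of $c$ under the coupling invariant $I$, written $c\sqsubseteq_I d$, if $\operatorname{inv} I\Cap c\succeq\operatorname{inv} I\Cap d$. Then for every $I\subseteq\Sigma$, all commands $c,d,c_1,c_2,d_1,d_2$ and all sets $C,D$ of commands: 1. $\bigvee C\sqsubseteq_I\bigvee D$ if for every $d\in D$ there is $c\in C$ with $c\sqsubseteq_I d$; 2. $c_1\vee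 c_2\sqsubseteq_I d_1\vee d_2$ if $c_1\sqsubseteq_I d_1$ and $c_2\sqsubseteq_I d_2$; 3. $c_1;c_2\sqsubseteq_I d_1;d_2$ if $c_1\sqsubseteq_I d_1$ and $c_2\sqsubseteq_I d_2$; 4. $c_1\parallel c_2\sqsubseteq_I d_1\parallel d_2$ if $c_1\sqsubseteq_I d_1$ and $c_2\sqsubseteq_I d_2$; 5. $c_1\Cap c_2\sqsubseteq_I d_1\Cap d_2$ if $c_1\sqsubseteq_I d_1$ and $c_2\sqsubseteq_I d_2$; 6. $c^{\star}\sqsubseteq_I d^{\star}$ if $c\sqsubseteq_I d$; 7. $c^{\omega}\sqsubseteq_I d^{\omega}$ if $c\sqsubseteq_I d$. -/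

import Mathlib

/-!
Commands of a concurrent wide-spectrum language, modelled by sets of Aczel traces
over a type `S` of program states.
-/

universe u

namespace RG

/-- A transition is made either by the program (`π`) or by its environment (`ε`). -/
inductive Kind where
  | prog
  | env

/-- One transition of an Aczel trace: who makes it, and the state that it leads to. -/
structure Step (S : Type u) where
  kind : Kind
  state : S

/-- How a finite trace ends: normal termination, irrecoverable failure (abort), or neither, that
is, a partial behaviour, which may have become infeasible. -/
inductive Ending where
  | terminated
  | aborted
  | incomplete

/-- An Aczel trace: an initial state followed by a finite or an infinite sequence of steps. -/
inductive Trace (S : Type u) where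
  | fin (σ : S) (s : List (Step S)) (e : Ending)
  | inf (σ : S) (f : Stream' (Step S))

/-- The state reached from the initial state `σ` by the steps `s`. -/
def lastState {S : Type u} (σ : S) (s : List (Step S)) : S :=
  s.foldl (fun _ x => x.state) σ

namespace Trace

variable {S : Type u}

/-- The initial state of a trace. -/
def first : Trace S → S
  | fin σ _ _ => σ
  | inf σ _ => σ

/-- `t.Extends σ s`: the trace `t` starts in `σ` and its sequence of steps starts with `s`. -/
def Extends : Trace S → S → List (Step S) → Prop
  | fin σ' s' _, σ, s => σ' = σ ∧ s <+: s'
  | inf σ' f, σ, s => σ' = σ ∧ ∃ g : Stream' (Step S), f = s ++ₛ g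

/-- The trace that starts in `σ`, makes the steps `s`, and goes on with the steps of the given
trace (used when the latter starts in the state reached by `s`). -/
def prepend (σ : S) (s : List (Step S)) : Trace S → Trace S
  | fin _ s' e => fin σ (s ++ s') e
  | inf _ f => inf σ (s ++ₛ f)

theorem Extends.mono {t : Trace S} {σ σ' : S} {s s' : List (Step S)} {e : Ending}
    (h : t.Extends σ s) (h' : (fin σ s e).Extends σ' s') : t.Extends σ' s' := by
  obtain ⟨rfl, r, rfl⟩ := h'
  cases t with
  | fin σ₀ s₀ e₀ => exact ⟨h.1, (List.prefix_append s' r).trans h.2⟩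
  | inf σ₀ f =>
    obtain ⟨h1, g, hg⟩ := h
    exact ⟨h1, r ++ₛ g, by rw [hg, Stream'.append_append_stream]⟩

/-- Two prefixes of one trace are comparable. -/
theorem Extends.total {t : Trace S} {σ σ' : S} {s s' : List (Step S)}
    (h : t.Extends σ s) (h' : t.Extends σ' s') : σ = σ' ∧ (s <+: s' ∨ s' <+: s) := by
  cases t with
  | fin σ₀ s₀ e₀ => exact ⟨h.1.symm.trans h'.1, List.prefix_or_prefix_of_prefix h.2 h'.2⟩
  | inf σ₀ f =>
    obtain ⟨h1, g, hg⟩ := h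
    obtain ⟨h2, g', hg'⟩ := h'
    refine ⟨h1.symm.trans h2, ?_⟩
    have key : ∀ (a : List (Step S)) (k : Stream' (Step S)),
        a = Stream'.take a.length (a ++ₛ k) := fun a k => by
      have h := Stream'.append_take 0 a k
      simpa [Stream'.take] using h
    have ha : s = f.take s.length := by rw [hg]; exact key _ _
    have hb : s' = f.take s'.length := by rw [hg']; exact key _ _
    rw [ha, hb]
    rcases le_total s.length s'.length with hl | hl
    · left; exact Stream'.take_prefix_take_left _ _ f hl
    · right; exact Stream'.take_prefix_take_left _ _ f hl

end Trace

/-- A command is a set of traces that contains the empty incomplete trace from every state (which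
is all that an infeasible command can do), and that is prefix closed and abort closed: every
finite initial part of a possible behaviour is possible as a partial behaviour, and after an abort
any behaviour is possible. -/
@[ext] structure Command (S : Type u) where
  traces : Set (Trace S)
  start : ∀ σ, Trace.fin σ [] .incomplete ∈ traces
  prefix_closed : ∀ t σ s, t ∈ traces → t.Extends σ s → Trace.fin σ s .incomplete ∈ traces
  abort_closed : ∀ t σ s, Trace.fin σ s .aborted ∈ traces → t.Extends σ s → t ∈ traces

namespace Command

variable {S : Type u}

/-- Commands are ordered by inclusion of their sets of traces. So `c ≥ d` says that `c` is refined
(implemented) by `d`. -/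
instance : PartialOrder (Command S) where
  le c d := c.traces ⊆ d.traces
  le_refl c := subset_rfl
  le_trans _ _ _ h₁ h₂ := h₁.trans h₂
  le_antisymm _ _ h₁ h₂ := Command.ext (h₁.antisymm h₂)

/-- The complete lattice of commands. The join, nondeterministic choice, is union; the meet, strong
conjunction, is intersection; the least command has only the empty incomplete traces, and the
greatest command has all traces. -/
instance : CompleteLattice (Command S) where
  sup c d :=
    { traces := c.traces ∪ d.traces
      start := fun σ => Or.inl (c.start σ)
      prefix_closed := fun t σ s h he =>
        h.imp (fun h => c.prefix_closed t σ s h he) (fun h => d.prefix_closed t σ s h he)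
      abort_closed := fun t σ s h he =>
        h.imp (fun h => c.abort_closed t σ s h he) (fun h => d.abort_closed t σ s h he) }
  inf c d :=
    { traces := c.traces ∩ d.traces
      start := fun σ => ⟨c.start σ, d.start σ⟩
      prefix_closed := fun t σ s h he =>
        ⟨c.prefix_closed t σ s h.1 he, d.prefix_closed t σ s h.2 he⟩
      abort_closed := fun t σ s h he =>
        ⟨c.abort_closed t σ s h.1 he, d.abort_closed t σ s h.2 he⟩ }
  sSup C :=
    { traces := {t | (∃ σ, t = Trace.fin σ [] .incomplete) ∨ ∃ c ∈ C, t ∈ c.traces}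
      start := fun σ => Or.inl ⟨σ, rfl⟩
      prefix_closed := by
        rintro t σ s (⟨σ', rfl⟩ | ⟨c, hc, h⟩) he
        · obtain ⟨-, he⟩ := he
          obtain rfl := List.prefix_nil.1 he
          exact Or.inl ⟨σ, rfl⟩
        · exact Or.inr ⟨c, hc, c.prefix_closed t σ s h he⟩
      abort_closed := by
        rintro t σ s (⟨σ', h⟩ | ⟨c, hc, h⟩) he
        · cases h
        · exact Or.inr ⟨c, hc, c.abort_closed t σ s h he⟩ }
  sInf C :=
    { traces := {t | ∀ c ∈ C, t ∈ c.traces}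
      start := fun σ c _ => c.start σ
      prefix_closed := fun t σ s h he c hc => c.prefix_closed t σ s (h c hc) he
      abort_closed := fun t σ s h he c hc => c.abort_closed t σ s (h c hc) he }
  top :=
    { traces := Set.univ
      start := fun _ => trivial
      prefix_closed := fun _ _ _ _ _ => trivial
      abort_closed := fun _ _ _ _ _ => trivial }
  bot :=
    { traces := {t | ∃ σ, t = Trace.fin σ [] .incomplete}
      start := fun σ => ⟨σ, rfl⟩
      prefix_closed := by
        rintro t σ s ⟨σ', rfl⟩ ⟨-, he⟩
        obtain rfl := List.prefix_nil.1 he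
        exact ⟨σ, rfl⟩
      abort_closed := by
        rintro t σ s ⟨σ', h⟩ he
        cases h }
  le_sup_left _ _ _ h := Or.inl h
  le_sup_right _ _ _ h := Or.inr h
  sup_le _ _ _ h₁ h₂ _ h := h.elim (fun h => h₁ h) (fun h => h₂ h)
  inf_le_left _ _ _ h := h.1
  inf_le_right _ _ _ h := h.2
  le_inf _ _ _ h₁ h₂ _ h := ⟨h₁ h, h₂ h⟩
  isLUB_sSup C := by
    refine ⟨fun c hc t ht => Or.inr ⟨c, hc, ht⟩, fun d hd t ht => ?_⟩
    rcases ht with ⟨σ, rfl⟩ | ⟨c, hc, ht⟩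
    · exact d.start σ
    · exact hd hc ht
  isGLB_sInf C := ⟨fun c hc t ht => ht c hc, fun d hd t ht c hc => hd hc ht⟩
  le_top _ _ _ := trivial
  bot_le c t h := by
    obtain ⟨σ, rfl⟩ := h
    exact c.start σ

/-- The command generated by a set `T` of traces, that is, the least command that has all traces
in `T`: it adds the empty incomplete traces, the finite prefixes of traces in `T` as incomplete
traces, and every trace that extends an aborted trace in `T`. -/
def ofTraces (T : Set (Trace S)) : Command S where
  traces := {t | t ∈ T ∨ (∃ σ, t = Trace.fin σ [] .incomplete) ∨
    (∃ t' ∈ T, ∃ σ s, t'.Extends σ s ∧ t = Trace.fin σ s .incomplete) ∨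
    (∃ σ s, Trace.fin σ s .aborted ∈ T ∧ t.Extends σ s)}
  start σ := Or.inr (Or.inl ⟨σ, rfl⟩)
  prefix_closed := by
    rintro t σ s (h | ⟨σ', rfl⟩ | ⟨t', h, σ', s', he', rfl⟩ | ⟨σ', s', h, he'⟩) he
    · exact Or.inr (Or.inr (Or.inl ⟨t, h, σ, s, he, rfl⟩))
    · obtain ⟨-, he⟩ := he
      obtain rfl := List.prefix_nil.1 he
      exact Or.inr (Or.inl ⟨σ, rfl⟩)
    · exact Or.inr (Or.inr (Or.inl ⟨t', h, σ, s, he'.mono he, rfl⟩))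
    · obtain ⟨rfl, hp | hp⟩ := he.total he'
      · exact Or.inr (Or.inr (Or.inl ⟨_, h, σ, s, ⟨rfl, hp⟩, rfl⟩))
      · exact Or.inr (Or.inr (Or.inr ⟨σ, s', h, rfl, hp⟩))
  abort_closed := by
    rintro t σ s (h | ⟨σ', h⟩ | ⟨t', h, σ', s', he', h'⟩ | ⟨σ', s', h, he'⟩) he
    · exact Or.inr (Or.inr (Or.inr ⟨σ, s, h, he⟩))
    · cases h
    · cases h'
    · exact Or.inr (Or.inr (Or.inr ⟨σ', s', h, he.mono he'⟩))

theorem ofTraces_le {T : Set (Trace S)} {c : Command S} :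
    ofTraces T ≤ c ↔ T ⊆ c.traces := by
  refine ⟨fun h t ht => h (Or.inl ht), fun h t ht => ?_⟩
  rcases ht with ht | ⟨σ, rfl⟩ | ⟨t', ht', σ, s, he, rfl⟩ | ⟨σ, s, ht', he⟩
  · exact h ht
  · exact c.start σ
  · exact c.prefix_closed t' σ s (h ht') he
  · exact c.abort_closed t σ s (h ht') he

theorem subset_ofTraces (T : Set (Trace S)) : T ⊆ (ofTraces T).traces := fun _ h => Or.inl h

/-! ### Primitive commands -/

/-- The instantaneous test that the current state is in `p`: a no-op if it is, infeasible if it is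
not. -/
def test (p : Set S) : Command S :=
  ofTraces {t | ∃ σ ∈ p, t = Trace.fin σ [] .terminated}

/-- The atomic program command: a single program transition satisfying `r`. -/
def pstep (r : Set (S × S)) : Command S :=
  ofTraces {t | ∃ σ₀ σ, (σ₀, σ) ∈ r ∧ t = Trace.fin σ₀ [⟨.prog, σ⟩] .terminated}

/-- The atomic environment command: a single environment transition satisfying `r`. -/
def estep (r : Set (S × S)) : Command S :=
  ofTraces {t | ∃ σ₀ σ, (σ₀, σ) ∈ r ∧ t = Trace.fin σ₀ [⟨.env, σ⟩] .terminated}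

/-- Dijkstra's abort command: it irrecoverably fails immediately, in any state. -/
def abort : Command S :=
  ofTraces {t | ∃ σ, t = Trace.fin σ [] .aborted}

theorem abort_eq_top : (abort : Command S) = ⊤ := by
  refine top_unique fun t _ => ?_
  refine Or.inr (Or.inr (Or.inr ⟨t.first, [], ⟨_, rfl⟩, ?_⟩))
  cases t with
  | fin σ s e => exact ⟨rfl, List.nil_prefix⟩
  | inf σ f => exact ⟨rfl, f, rfl⟩

/-! ### Binary operators -/

/-- Sequential composition: a trace of `c` that does not terminate (it is aborted, incomplete or
infinite), or a terminated trace of `c` followed by a trace of `d` from the state reached. -/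
def seq (c d : Command S) : Command S :=
  ofTraces ({t | t ∈ c.traces ∧ ∀ σ s, t ≠ Trace.fin σ s .terminated} ∪
    {t | ∃ σ s t', Trace.fin σ s .terminated ∈ c.traces ∧ t' ∈ d.traces ∧
      t'.first = lastState σ s ∧ t = t'.prepend σ s})

/-- Weak conjunction: the common traces of `c` and `d`, except that the conjunction aborts as soon
as one operand aborts while the other one allows the steps made so far. -/
def wconj (c d : Command S) : Command S :=
  ofTraces ((c.traces ∩ d.traces) ∪
    {t | ∃ σ s, t = Trace.fin σ s .aborted ∧
      (Trace.fin σ s .aborted ∈ c.traces ∧ Trace.fin σ s .incomplete ∈ d.traces ∨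
        Trace.fin σ s .incomplete ∈ c.traces ∧ Trace.fin σ s .aborted ∈ d.traces)})

/-- `ParKind k₁ k₂ k`: transitions of the kinds `k₁` and `k₂` of two parallel processes are one
transition of the kind `k` of their composition. A program transition of one process is an
environment transition of the other one; a common environment transition is an environment
transition of the composition; two program transitions cannot be made at once. -/
inductive ParKind : Kind → Kind → Kind → Prop
  | left : ParKind .prog .env .prog
  | right : ParKind .env .prog .prog
  | env : ParKind .env .env .env

/-- Synchronisation of a step of each of two parallel processes, which share the state. -/
def ParStep (x₁ x₂ x : Step S) : Prop :=
  ParKind x₁.kind x₂.kind x.kind ∧ x₁.state = x.state ∧ x₂.state = x.state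

/-- Step by step synchronisation of finite sequences of steps of the same length. -/
inductive ParSteps : List (Step S) → List (Step S) → List (Step S) → Prop
  | nil : ParSteps [] [] []
  | cons {x₁ x₂ x : Step S} {s₁ s₂ s : List (Step S)} :
      ParStep x₁ x₂ x → ParSteps s₁ s₂ s → ParSteps (x₁ :: s₁) (x₂ :: s₂) (x :: s)

/-- Parallel composition: the operands synchronise on every step; they terminate together, and the
composition aborts as soon as one operand aborts while the other one allows its part of the steps
made so far. -/
def par (c d : Command S) : Command S :=
  ofTraces (
    {t | ∃ σ s₁ s₂ s, ∃ e : Ending, e ≠ .aborted ∧ ParSteps s₁ s₂ s ∧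
      Trace.fin σ s₁ e ∈ c.traces ∧ Trace.fin σ s₂ e ∈ d.traces ∧ t = Trace.fin σ s e} ∪
    {t | ∃ σ, ∃ f₁ f₂ f : Stream' (Step S), (∀ n, ParStep (f₁.get n) (f₂.get n) (f.get n)) ∧
      Trace.inf σ f₁ ∈ c.traces ∧ Trace.inf σ f₂ ∈ d.traces ∧ t = Trace.inf σ f} ∪
    {t | ∃ σ s₁ s₂ s, ParSteps s₁ s₂ s ∧ t = Trace.fin σ s .aborted ∧
      (Trace.fin σ s₁ .aborted ∈ c.traces ∧ Trace.fin σ s₂ .incomplete ∈ d.traces ∨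
        Trace.fin σ s₁ .incomplete ∈ c.traces ∧ Trace.fin σ s₂ .aborted ∈ d.traces)})

theorem seq_mono_right (c : Command S) : Monotone (seq c) := by
  intro d d' h
  refine ofTraces_le.2 (Set.Subset.trans ?_ (subset_ofTraces _))
  rintro t (ht | ⟨σ, s, t', h₁, h₂, h₃, rfl⟩)
  · exact Or.inl ht
  · exact Or.inr ⟨σ, s, t', h₁, h h₂, h₃, rfl⟩

/-! ### Derived commands -/

/-- The command `τ`: the test that always succeeds. -/
def nil : Command S := test Set.univ

/-- The assertion `{p}`: it aborts if the current state is not in `p`, else it is a no-op. -/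
def pre (p : Set S) : Command S := nil ⊔ seq (test pᶜ) abort

/-- A single program or environment transition satisfying `r`. -/
def cstep (r : Set (S × S)) : Command S := pstep r ⊔ estep r

/-- The function `y ↦ τ ∨ c ; y`. -/
def unfold (c : Command S) : Command S →o Command S where
  toFun y := nil ⊔ seq c y
  monotone' _ _ h := sup_le_sup_left (seq_mono_right c h) _

/-- Finite iteration: the least fixed point of `y ↦ τ ∨ c ; y`. -/
def finIter (c : Command S) : Command S := OrderHom.lfp (unfold c)

/-- Possibly infinite iteration: the greatest fixed point of `y ↦ τ ∨ c ; y`. -/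
def omIter (c : Command S) : Command S := OrderHom.gfp (unfold c)

/-! ### Invariants and data reification -/

/-- The relation between states whose final state is in `p`. -/
def postRel (p : Set S) : Set (S × S) := {x | x.2 ∈ p}

/-- Any number of transitions, finite or infinite, of the program or of the environment, each of
which satisfies `r`. -/
def promise (r : Set (S × S)) : Command S := omIter (cstep r)

/-- The invariant command: under the assumption that the initial state is in `I`, every transition
establishes `I`. -/
def inv (I : Set S) : Command S := seq (pre I) (promise (postRel I))

/-- `Reifies I c d`: the command `d` is a data reification of the command `c` under the coupling
invariant `I`. -/
def Reifies (I : Set S) (c d : Command S) : Prop :=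
  wconj (inv I) c ≥ wconj (inv I) d

end Command

end RG

namespace RG

variable {S : Type u}

namespace Trace

/-- All states of the trace lie in `I`. -/
def Within (I : Set S) : Trace S → Prop
  | fin σ s _ => σ ∈ I ∧ ∀ x ∈ s, x.state ∈ I
  | inf σ f => σ ∈ I ∧ ∀ n, (f.get n).state ∈ I

/-- The trace is not marked as aborted. -/
def NotAborted (t : Trace S) : Prop := ∀ σ s, t ≠ fin σ s .aborted

theorem Extends.eq_take {σ σ' : S} {f : Stream' (Step S)} {s : List (Step S)}
    (h : (inf σ' f).Extends σ s) : s = f.take s.length := by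
  obtain ⟨-, g, rfl⟩ := h
  have h := Stream'.append_take 0 s g
  simpa [Stream'.take] using h

theorem extends_take (σ : S) (f : Stream' (Step S)) (n : ℕ) :
    (inf σ f).Extends σ (f.take n) :=
  ⟨rfl, f.drop n, (Stream'.append_take_drop n f).symm⟩

theorem extends_nil (t : Trace S) : t.Extends t.first [] := by
  cases t with
  | fin σ s e => exact ⟨rfl, List.nil_prefix⟩
  | inf σ f => exact ⟨rfl, f, rfl⟩

theorem Extends.first_eq {t : Trace S} {σ : S} {s : List (Step S)} (h : t.Extends σ s) :
    t.first = σ := by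
  cases t <;> exact h.1

theorem Within.first_mem {I : Set S} {t : Trace S} (h : t.Within I) : t.first ∈ I := by
  cases t <;> exact h.1

theorem Within.of_extends {I : Set S} {t : Trace S} {σ : S} {s : List (Step S)}
    (h : t.Within I) (he : t.Extends σ s) (e : Ending) : (fin σ s e).Within I := by
  cases t with
  | fin σ' s' e' =>
    obtain ⟨rfl, hp⟩ := he
    exact ⟨h.1, fun x hx => h.2 x (hp.subset hx)⟩
  | inf σ' f =>
    obtain ⟨rfl, g, rfl⟩ := he
    refine ⟨h.1, fun x hx => ?_⟩
    obtain ⟨n, hn, rfl⟩ := List.mem_iff_getElem.1 hx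
    have := h.2 n
    rwa [Stream'.get_append_left n s g hn] at this

/-- A trace that extends the start of a concatenation either stops within the first part, or goes
on with a trace that extends the start of the second part. -/
theorem Extends.of_prepend {σ σ' : S} {s s' : List (Step S)} {t : Trace S}
    (h : (t.prepend σ s).Extends σ' s') :
    σ = σ' ∧ (s' <+: s ∨ ∃ r, s' = s ++ r ∧ t.Extends t.first r) := by
  have hs : (t.prepend σ s).Extends σ s := by
    cases t with
    | fin σ₀ s₀ e => exact ⟨rfl, s₀, rfl⟩
    | inf σ₀ f => exact ⟨rfl, f, rfl⟩
  obtain ⟨rfl, hp | hp⟩ := h.total hs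
  · exact ⟨rfl, Or.inl hp⟩
  · obtain ⟨r, rfl⟩ := hp
    refine ⟨rfl, Or.inr ⟨r, rfl, ?_⟩⟩
    cases t with
    | fin σ₀ s₀ e => exact ⟨rfl, (List.prefix_append_right_inj s).1 h.2⟩
    | inf σ₀ f =>
      obtain ⟨-, g, hg⟩ := h
      rw [Stream'.append_append_stream] at hg
      exact ⟨rfl, g, Stream'.append_right_injective s _ _ hg⟩

/-- A trace that extends `s ++ r` is the concatenation of `s` with a trace that extends `r`. -/
theorem Extends.exists_prepend {σ : S} {s r : List (Step S)} {t : Trace S}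
    (h : t.Extends σ (s ++ r)) (σ' : S) : ∃ t' : Trace S, t'.Extends σ' r ∧ t = t'.prepend σ s := by
  cases t with
  | fin σ₀ s₀ e =>
    obtain ⟨rfl, q, rfl⟩ := h
    exact ⟨fin σ' (r ++ q) e, ⟨rfl, q, rfl⟩, by simp [prepend]⟩
  | inf σ₀ f =>
    obtain ⟨rfl, g, rfl⟩ := h
    exact ⟨inf σ' (r ++ₛ g), ⟨rfl, g, rfl⟩, by simp [prepend, Stream'.append_append_stream]⟩

theorem lastState_mem {I : Set S} {σ : S} {s : List (Step S)} (hσ : σ ∈ I)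
    (hs : ∀ x ∈ s, x.state ∈ I) : lastState σ s ∈ I := by
  induction s generalizing σ with
  | nil => exact hσ
  | cons x s ih =>
    exact ih (hs x (by simp)) fun y hy => hs y (by simp [hy])

theorem within_prepend {I : Set S} {σ : S} {s : List (Step S)} {t : Trace S}
    (h : (t.prepend σ s).Within I) (ht : t.first = lastState σ s) :
    (∀ e, (fin σ s e).Within I) ∧ t.Within I := by
  have h₁ : ∀ e, (fin σ s e).Within I := by
    refine fun e => h.of_extends ?_ e
    cases t with
    | fin σ₀ s₀ e => exact ⟨rfl, s₀, rfl⟩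
    | inf σ₀ f => exact ⟨rfl, f, rfl⟩
  refine ⟨h₁, ?_⟩
  have hl := lastState_mem (h₁ .incomplete).1 (h₁ .incomplete).2
  rw [← ht] at hl
  cases t with
  | fin σ₀ s₀ e => exact ⟨hl, fun x hx => h.2 x (List.mem_append_right s hx)⟩
  | inf σ₀ f =>
    refine ⟨hl, fun n => ?_⟩
    have := h.2 (s.length + n)
    rwa [Stream'.get_append_right] at this

end Trace

namespace Command

/-- A set of traces that contains with every trace its finite prefixes as incomplete traces. -/
def PrefixClosed (T : Set (Trace S)) : Prop :=
  ∀ t ∈ T, ∀ σ s, t.Extends σ s → Trace.fin σ s .incomplete ∈ T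

/-- To show that the traces with a prefix closed property `P` that are generated by a prefix closed
set `T` belong to `c`, it is enough to consider the elements of `T`. -/
theorem mem_of_mem_ofTraces {T : Set (Trace S)} (hT : PrefixClosed T) {c : Command S}
    {P : Trace S → Prop} (hP : ∀ t σ s, P t → t.Extends σ s → P (.fin σ s .aborted))
    (h : ∀ t ∈ T, P t → t ∈ c.traces) {t : Trace S} (ht : t ∈ (ofTraces T).traces) (hPt : P t) :
    t ∈ c.traces := by
  rcases ht with ht | ⟨σ, rfl⟩ | ⟨t', ht', σ, s, he, rfl⟩ | ⟨σ, s, ht', he⟩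
  · exact h t ht hPt
  · exact c.start σ
  · exact h _ (hT t' ht' σ s he) hPt
  · exact c.abort_closed t σ s (h _ ht' (hP t σ s hPt he)) he

/-! ### The generating sets of traces of the binary operators -/

/-- The set of traces that generates `seq c d`. -/
def seqTraces (c d : Command S) : Set (Trace S) :=
  {t | t ∈ c.traces ∧ ∀ σ s, t ≠ Trace.fin σ s .terminated} ∪
    {t | ∃ σ s t', Trace.fin σ s .terminated ∈ c.traces ∧ t' ∈ d.traces ∧
      t'.first = lastState σ s ∧ t = t'.prepend σ s}

/-- The set of traces that generates `wconj c d`. -/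
def wconjTraces (c d : Command S) : Set (Trace S) :=
  (c.traces ∩ d.traces) ∪
    {t | ∃ σ s, t = Trace.fin σ s .aborted ∧
      (Trace.fin σ s .aborted ∈ c.traces ∧ Trace.fin σ s .incomplete ∈ d.traces ∨
        Trace.fin σ s .incomplete ∈ c.traces ∧ Trace.fin σ s .aborted ∈ d.traces)}

/-- The set of traces that generates `par c d`. -/
def parTraces (c d : Command S) : Set (Trace S) :=
  {t | ∃ σ s₁ s₂ s, ∃ e : Ending, e ≠ .aborted ∧ ParSteps s₁ s₂ s ∧
      Trace.fin σ s₁ e ∈ c.traces ∧ Trace.fin σ s₂ e ∈ d.traces ∧ t = Trace.fin σ s e} ∪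
    {t | ∃ σ, ∃ f₁ f₂ f : Stream' (Step S), (∀ n, ParStep (f₁.get n) (f₂.get n) (f.get n)) ∧
      Trace.inf σ f₁ ∈ c.traces ∧ Trace.inf σ f₂ ∈ d.traces ∧ t = Trace.inf σ f} ∪
    {t | ∃ σ s₁ s₂ s, ParSteps s₁ s₂ s ∧ t = Trace.fin σ s .aborted ∧
      (Trace.fin σ s₁ .aborted ∈ c.traces ∧ Trace.fin σ s₂ .incomplete ∈ d.traces ∨
        Trace.fin σ s₁ .incomplete ∈ c.traces ∧ Trace.fin σ s₂ .aborted ∈ d.traces)}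

theorem prefixClosed_seqTraces (c d : Command S) : PrefixClosed (seqTraces c d) := by
  rintro t (⟨ht, -⟩ | ⟨σ, s, t', hc, hd, hf, rfl⟩) σ' s' he
  · exact Or.inl ⟨c.prefix_closed t σ' s' ht he, fun _ _ h => by cases h⟩
  · obtain ⟨rfl, hp | ⟨r, rfl, hr⟩⟩ := he.of_prepend
    · exact Or.inl ⟨c.prefix_closed _ σ s' hc ⟨rfl, hp⟩, fun _ _ h => by cases h⟩
    · exact Or.inr ⟨σ, s, .fin t'.first r .incomplete, hc, d.prefix_closed t' _ r hd hr, hf, rfl⟩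

theorem prefixClosed_wconjTraces (c d : Command S) : PrefixClosed (wconjTraces c d) := by
  rintro t (⟨hc, hd⟩ | ⟨σ, s, rfl, ⟨hc, hd⟩ | ⟨hc, hd⟩⟩) σ' s' he
  · exact Or.inl ⟨c.prefix_closed t σ' s' hc he, d.prefix_closed t σ' s' hd he⟩
  all_goals exact Or.inl ⟨c.prefix_closed _ σ' s' hc he, d.prefix_closed _ σ' s' hd he⟩

theorem ParSteps.exists_prefix {s₁ s₂ s p : List (Step S)} (h : ParSteps s₁ s₂ s) (hp : p <+: s) :
    ∃ p₁ p₂, p₁ <+: s₁ ∧ p₂ <+: s₂ ∧ ParSteps p₁ p₂ p := by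
  induction h generalizing p with
  | nil =>
    obtain rfl := List.prefix_nil.1 hp
    exact ⟨[], [], List.nil_prefix, List.nil_prefix, .nil⟩
  | cons hx _ ih =>
    rcases List.prefix_cons_iff.1 hp with rfl | ⟨q, rfl, hq⟩
    · exact ⟨[], [], List.nil_prefix, List.nil_prefix, .nil⟩
    · obtain ⟨q₁, q₂, h₁, h₂, hq⟩ := ih hq
      exact ⟨_ :: q₁, _ :: q₂, (List.prefix_cons_inj _).2 h₁, (List.prefix_cons_inj _).2 h₂,
        .cons hx hq⟩

theorem parSteps_take {f₁ f₂ f : Stream' (Step S)}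
    (h : ∀ n, ParStep (f₁.get n) (f₂.get n) (f.get n)) (n : ℕ) :
    ParSteps (f₁.take n) (f₂.take n) (f.take n) := by
  induction n generalizing f₁ f₂ f with
  | zero => exact .nil
  | succ n ih => exact .cons (h 0) (ih fun n => h (n + 1))

theorem ParSteps.states_mem {I : Set S} {s₁ s₂ s : List (Step S)} (h : ParSteps s₁ s₂ s)
    (hs : ∀ x ∈ s, x.state ∈ I) : (∀ x ∈ s₁, x.state ∈ I) ∧ ∀ x ∈ s₂, x.state ∈ I := by
  induction h with
  | nil => simp
  | cons hx _ ih =>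
    simp only [List.forall_mem_cons] at hs ⊢
    obtain ⟨h₁, h₂⟩ := ih hs.2
    exact ⟨⟨hx.2.1 ▸ hs.1, h₁⟩, hx.2.2 ▸ hs.1, h₂⟩

theorem prefixClosed_parTraces (c d : Command S) : PrefixClosed (parTraces c d) := by
  have key : ∀ {σ s₁ s₂ s e₁ e₂ s'}, ParSteps s₁ s₂ s → Trace.fin σ s₁ e₁ ∈ c.traces →
      Trace.fin σ s₂ e₂ ∈ d.traces → s' <+: s → .fin σ s' .incomplete ∈ parTraces c d := by
    intro σ s₁ s₂ s e₁ e₂ s' h hc hd hp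
    obtain ⟨p₁, p₂, h₁, h₂, hp⟩ := h.exists_prefix hp
    exact Or.inl (Or.inl ⟨σ, p₁, p₂, s', .incomplete, by simp, hp,
      c.prefix_closed _ σ p₁ hc ⟨rfl, h₁⟩, d.prefix_closed _ σ p₂ hd ⟨rfl, h₂⟩, rfl⟩)
  rintro t ((⟨σ, s₁, s₂, s, e, -, h, hc, hd, rfl⟩ | ⟨σ, f₁, f₂, f, h, hc, hd, rfl⟩) |
    ⟨σ, s₁, s₂, s, h, rfl, ⟨hc, hd⟩ | ⟨hc, hd⟩⟩) σ' s' he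
  · obtain ⟨rfl, hp⟩ := he
    exact key h hc hd hp
  · rw [he.eq_take, ← he.1]
    exact Or.inl (Or.inl ⟨σ, _, _, _, .incomplete, by simp, parSteps_take h s'.length,
      c.prefix_closed _ σ _ hc (Trace.extends_take σ f₁ _),
      d.prefix_closed _ σ _ hd (Trace.extends_take σ f₂ _), rfl⟩)
  all_goals
    obtain ⟨rfl, hp⟩ := he
    exact key h hc hd hp

/-! ### The traces of the invariant command -/

theorem mem_nil {t : Trace S} :
    t ∈ (nil : Command S).traces ↔ ∃ σ, t = .fin σ [] .terminated ∨ t = .fin σ [] .incomplete := by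
  constructor
  · rintro (⟨σ, -, rfl⟩ | ⟨σ, rfl⟩ | ⟨_, ⟨σ, -, rfl⟩, σ', s, ⟨rfl, hp⟩, rfl⟩ | ⟨σ, s, ⟨σ', -, h⟩, -⟩)
    · exact ⟨σ, Or.inl rfl⟩
    · exact ⟨σ, Or.inr rfl⟩
    · obtain rfl := List.prefix_nil.1 hp
      exact ⟨_, Or.inr rfl⟩
    · cases h
  · rintro ⟨σ, rfl | rfl⟩
    · exact Or.inl ⟨σ, trivial, rfl⟩
    · exact nil.start σ

theorem mem_cstep {r : Set (S × S)} {t : Trace S} :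
    t ∈ (cstep r).traces ↔ (∃ σ, t = .fin σ [] .incomplete) ∨
      ∃ σ x, (σ, x.state) ∈ r ∧ (t = .fin σ [x] .terminated ∨ t = .fin σ [x] .incomplete) := by
  have key : ∀ {k : Kind}, t ∈ (ofTraces {t | ∃ σ₀ σ, (σ₀, σ) ∈ r ∧
      t = Trace.fin σ₀ [⟨k, σ⟩] .terminated}).traces → (∃ σ, t = .fin σ [] .incomplete) ∨
      ∃ σ x, (σ, x.state) ∈ r ∧ (t = .fin σ [x] .terminated ∨ t = .fin σ [x] .incomplete) := by
    rintro k (⟨σ₀, σ, h, rfl⟩ | ⟨σ, rfl⟩ | ⟨_, ⟨σ₀, σ, h, rfl⟩, σ', s, ⟨rfl, hp⟩, rfl⟩ |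
      ⟨_, _, ⟨_, _, -, h⟩, -⟩)
    · exact Or.inr ⟨σ₀, _, h, Or.inl rfl⟩
    · exact Or.inl ⟨σ, rfl⟩
    · rcases List.prefix_cons_iff.1 hp with rfl | ⟨q, rfl, hq⟩
      · exact Or.inl ⟨_, rfl⟩
      · obtain rfl := List.prefix_nil.1 hq
        exact Or.inr ⟨_, _, h, Or.inr rfl⟩
    · cases h
  refine ⟨fun h => h.elim key key, ?_⟩
  have hx : ∀ σ x, (σ, x.state) ∈ r → .fin σ [x] .terminated ∈ (cstep r).traces := by
    rintro σ ⟨_ | _, σ'⟩ h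
    · exact Or.inl (Or.inl ⟨σ, σ', h, rfl⟩)
    · exact Or.inr (Or.inl ⟨σ, σ', h, rfl⟩)
  rintro (⟨σ, rfl⟩ | ⟨σ, x, h, rfl | rfl⟩)
  · exact (cstep r).start σ
  · exact hx σ x h
  · exact (cstep r).prefix_closed _ _ _ (hx σ x h) ⟨rfl, List.prefix_rfl⟩

theorem mem_seq_cstep {r : Set (S × S)} {y : Command S} {t : Trace S}
    (h : t ∈ (seq (cstep r) y).traces) : (∃ σ, t = .fin σ [] .incomplete) ∨
      ∃ σ x t', (σ, x.state) ∈ r ∧ t' ∈ y.traces ∧ t = t'.prepend σ [x] := by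
  have key : ∀ t ∈ seqTraces (cstep r) y, (∃ σ, t = .fin σ [] .incomplete) ∨
      ∃ σ x t', (σ, x.state) ∈ r ∧ t' ∈ y.traces ∧ t'.first = x.state ∧ t = t'.prepend σ [x] := by
    rintro t (⟨ht, hn⟩ | ⟨σ, s, t', hc, hy, hf, rfl⟩)
    · rcases mem_cstep.1 ht with h | ⟨σ, x, h, rfl | rfl⟩
      · exact Or.inl h
      · exact absurd rfl (hn _ _)
      · exact Or.inr ⟨σ, x, .fin x.state [] .incomplete, h, y.start _, rfl, rfl⟩
    · rcases mem_cstep.1 hc with ⟨_, h⟩ | ⟨σ', x, h, h' | h'⟩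
      · cases h
      · cases h'
        exact Or.inr ⟨σ, x, t', h, hy, hf, rfl⟩
      · cases h'
  have key' : ∀ t ∈ seqTraces (cstep r) y, (∃ σ, t = .fin σ [] .incomplete) ∨
      ∃ σ x t', (σ, x.state) ∈ r ∧ t' ∈ y.traces ∧ t = t'.prepend σ [x] := fun t ht =>
    (key t ht).imp_right fun ⟨σ, x, t', h₁, h₂, _, h₃⟩ => ⟨σ, x, t', h₁, h₂, h₃⟩
  rcases h with h | h | ⟨t', ht', σ, s, he, rfl⟩ | ⟨σ, s, ht', he⟩
  · exact key' t h
  · exact Or.inl h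
  · exact key' _ (prefixClosed_seqTraces _ _ t' ht' σ s he)
  · rcases key _ ht' with ⟨_, h⟩ | ⟨σ', x, t', hr, hy, hf, h⟩
    · cases h
    · cases t' with
      | fin σ₀ s₀ e =>
        cases h
        obtain ⟨t'', he', rfl⟩ := Trace.Extends.exists_prepend (s := [x]) he σ₀
        exact Or.inr ⟨σ, x, t'', hr, y.abort_closed t'' σ₀ s₀ hy he', rfl⟩
      | inf σ₀ f => cases h

/-- The command whose traces do not abort and make steps to states in `I` only. -/
def always (I : Set S) : Command S where
  traces := {t | t.NotAborted ∧ match t with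
    | .fin _ s _ => ∀ x ∈ s, x.state ∈ I
    | .inf _ f => ∀ n, (f.get n).state ∈ I}
  start σ := ⟨(fun _ _ h => by cases h), by simp⟩
  prefix_closed := by
    rintro t σ s ⟨-, h⟩ he
    refine ⟨(fun _ _ h => by cases h), ?_⟩
    cases t with
    | fin σ' s' e => exact fun x hx => h x (he.2.subset hx)
    | inf σ' f =>
      intro x hx
      obtain ⟨-, g, rfl⟩ := he
      obtain ⟨n, hn, rfl⟩ := List.mem_iff_getElem.1 hx
      have := h n
      rwa [Stream'.get_append_left n s g hn] at this
  abort_closed t σ s h := absurd rfl (h.1 σ s)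

theorem always_le_promise (I : Set S) : always I ≤ promise (postRel I) := by
  refine OrderHom.le_gfp _ ?_
  rintro (⟨σ, s, e⟩ | ⟨σ, f⟩) ⟨hn, h⟩
  · cases s with
    | nil =>
      cases e with
      | terminated => exact Or.inl (mem_nil.2 ⟨σ, Or.inl rfl⟩)
      | aborted => exact absurd rfl (hn _ _)
      | incomplete => exact Or.inl (mem_nil.2 ⟨σ, Or.inr rfl⟩)
    | cons x s =>
      refine Or.inr (Or.inl (Or.inr ⟨σ, [x], .fin x.state s e,
        mem_cstep.2 (Or.inr ⟨σ, x, h x (by simp), Or.inl rfl⟩), ⟨?_, ?_⟩, rfl, rfl⟩))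
      · rintro _ _ ⟨⟩
        exact hn _ _ rfl
      · exact fun y hy => h y (by simp [hy])
  · refine Or.inr (Or.inl (Or.inr ⟨σ, [f.head], .inf f.head.state f.tail,
      mem_cstep.2 (Or.inr ⟨σ, f.head, h 0, Or.inl rfl⟩), ⟨?_, ?_⟩, rfl, ?_⟩))
    · rintro _ _ ⟨⟩
    · exact fun n => h (n + 1)
    · simp only [Trace.prepend, Stream'.cons_append_stream, Stream'.nil_append_stream]
      rw [Stream'.eta]

theorem promise_le_always (I : Set S) : promise (postRel I) ≤ always I := by
  refine OrderHom.gfp_le _ fun y hy => ?_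
  have step : ∀ t ∈ y.traces,
      (∃ σ, t = .fin σ [] .terminated ∨ t = .fin σ [] .incomplete) ∨
      ∃ (σ : S) (x : Step S) (t' : Trace S), x.state ∈ I ∧ t' ∈ y.traces ∧
        t = t'.prepend σ [x] := by
    intro t ht
    rcases hy ht with h | h
    · exact Or.inl (mem_nil.1 h)
    · exact (mem_seq_cstep h).imp_left fun ⟨σ, h⟩ => ⟨σ, Or.inr h⟩
  rintro (⟨σ, s, e⟩ | ⟨σ, f⟩) ht
  · induction s generalizing σ with
    | nil =>
      rcases step _ ht with ⟨σ', h | h⟩ | ⟨σ', x, t', -, -, h⟩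
      · cases h
        exact ⟨(fun _ _ h => by cases h), by simp⟩
      · exact h ▸ (always I).start σ'
      · cases t' <;> cases h
    | cons x s ih =>
      rcases step _ ht with ⟨σ', h | h⟩ | ⟨σ', x', t', hx, ht', h⟩
      · cases h
      · cases h
      · cases t' with
        | fin σ₀ s₀ e₀ =>
          cases h
          obtain ⟨h₁, h₂⟩ := ih σ₀ ht'
          refine ⟨?_, List.forall_mem_cons.2 ⟨hx, h₂⟩⟩
          rintro _ _ ⟨⟩
          exact h₁ _ _ rfl
        | inf σ₀ f => cases h
  · refine ⟨(fun _ _ h => by cases h), fun n => ?_⟩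
    induction n generalizing σ f with
    | zero =>
      rcases step _ ht with ⟨σ', h | h⟩ | ⟨σ', x, t', hx, ht', h⟩
      · cases h
      · cases h
      · cases t' <;> cases h
        exact hx
    | succ n ih =>
      rcases step _ ht with ⟨σ', h | h⟩ | ⟨σ', x, t', hx, ht', h⟩
      · cases h
      · cases h
      · cases t' <;> cases h
        exact ih _ _ ht'

theorem promise_eq_always (I : Set S) : promise (postRel I) = always I :=
  (promise_le_always I).antisymm (always_le_promise I)

theorem mem_inv_of_first_notMem {I : Set S} {t : Trace S} (h : t.first ∉ I) :
    t ∈ (inv I).traces := by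
  refine (inv I).abort_closed t t.first [] (Or.inl (Or.inl ⟨Or.inr ?_, ?_⟩)) t.extends_nil
  · exact Or.inl (Or.inr ⟨t.first, [], .fin t.first [] .aborted, Or.inl ⟨_, h, rfl⟩,
      Or.inl ⟨_, rfl⟩, rfl, rfl⟩)
  · rintro _ _ ⟨⟩

theorem mem_inv_of_within {I : Set S} {t : Trace S} (h : t.Within I) (hn : t.NotAborted) :
    t ∈ (inv I).traces := by
  refine Or.inl (Or.inr ⟨t.first, [], t, Or.inl (mem_nil.2 ⟨_, Or.inl rfl⟩), ?_, rfl, ?_⟩)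
  · rw [promise_eq_always]
    refine ⟨hn, ?_⟩
    cases t <;> exact h.2
  · cases t <;> rfl

theorem mem_nil_of_mem_pre {I : Set S} {t : Trace S} (ht : t ∈ (pre I).traces)
    (h : t.first ∈ I) : t ∈ (nil : Command S).traces := by
  refine ht.elim id fun ht => ?_
  refine mem_of_mem_ofTraces (P := fun t => t.first ∈ I) (prefixClosed_seqTraces _ _)
    (fun t σ s h he => he.first_eq ▸ h) ?_ ht h
  have test_mem : ∀ t ∈ (test Iᶜ : Command S).traces, t.first ∈ I →
      t ∈ (⊥ : Command S).traces := by
    rintro t (⟨σ, hσ, rfl⟩ | ⟨σ, rfl⟩ | ⟨_, ⟨σ, hσ, rfl⟩, _, s, ⟨rfl, -⟩, rfl⟩ |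
      ⟨σ, s, ⟨_, -, h⟩, -⟩) hI
    · exact absurd hI hσ
    · exact ⟨σ, rfl⟩
    · exact absurd hI hσ
    · cases h
  rintro t (⟨ht, -⟩ | ⟨σ, s, t', ht, -, -, rfl⟩) hI
  · exact (bot_le : (⊥ : Command S) ≤ nil) (test_mem t ht hI)
  · have : σ ∈ I := by cases t' <;> exact hI
    obtain ⟨_, h⟩ := test_mem _ ht this
    cases h

theorem within_of_mem_inv {I : Set S} {t : Trace S} (ht : t ∈ (inv I).traces)
    (h : t.first ∈ I) : t.Within I ∧ t.NotAborted := by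
  have : t ∈ (always I).traces := by
    refine mem_of_mem_ofTraces (P := fun t => t.first ∈ I) (prefixClosed_seqTraces _ _)
      (fun t σ s h he => he.first_eq ▸ h) ?_ ht h
    rintro t (⟨ht, hn⟩ | ⟨σ, s, t', ht, ht', -, rfl⟩) hI
    · obtain ⟨σ, rfl | rfl⟩ := mem_nil.1 (mem_nil_of_mem_pre ht hI)
      · exact absurd rfl (hn _ _)
      · exact (always I).start σ
    · have hσ : σ ∈ I := by cases t' <;> exact hI
      obtain ⟨_, h | h⟩ := mem_nil.1 (mem_nil_of_mem_pre ht hσ)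
      · cases h
        rw [promise_eq_always] at ht'
        obtain ⟨h₁, h₂⟩ := ht'
        cases t' with
        | fin σ₀ s₀ e =>
          refine ⟨?_, h₂⟩
          rintro _ _ ⟨⟩
          exact h₁ _ _ rfl
        | inf σ₀ f => exact ⟨(fun _ _ h => by cases h), h₂⟩
      · cases h
  refine ⟨?_, this.1⟩
  cases t <;> exact ⟨h, this.2⟩

/-! ### Data reification -/

theorem mem_wconj_inv_of_within {I : Set S} {c : Command S} {t : Trace S} (ht : t ∈ c.traces)
    (h : t.Within I) : t ∈ (wconj (inv I) c).traces := by
  by_cases hn : t.NotAborted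
  · exact Or.inl (Or.inl ⟨mem_inv_of_within h hn, ht⟩)
  · simp only [Trace.NotAborted, not_forall, not_not] at hn
    obtain ⟨σ, s, rfl⟩ := hn
    exact Or.inl (Or.inr ⟨σ, s, rfl, Or.inr ⟨mem_inv_of_within h (fun _ _ h => by cases h), ht⟩⟩)

theorem mem_wconj_inv_of_first_notMem {I : Set S} {t : Trace S} (c : Command S)
    (h : t.first ∉ I) : t ∈ (wconj (inv I) c).traces :=
  (wconj (inv I) c).abort_closed t t.first [] (Or.inl (Or.inr ⟨_, _, rfl,
    Or.inl ⟨mem_inv_of_first_notMem h, c.start _⟩⟩)) t.extends_nil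

theorem mem_of_mem_wconj_inv {I : Set S} {c : Command S} {t : Trace S}
    (ht : t ∈ (wconj (inv I) c).traces) (h : t.first ∈ I) : t ∈ c.traces := by
  refine mem_of_mem_ofTraces (P := fun t => t.first ∈ I) (prefixClosed_wconjTraces _ _)
    (fun t σ s h he => he.first_eq ▸ h) ?_ ht h
  rintro t (⟨-, h⟩ | ⟨σ, s, rfl, ⟨h, -⟩ | ⟨-, h⟩⟩) hI
  · exact h
  · exact absurd rfl ((within_of_mem_inv h hI).2 σ s)
  · exact h

/-- Data reification under `I` is inclusion of the traces whose states all lie in `I`. -/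
theorem reifies_iff {I : Set S} {c d : Command S} :
    Reifies I c d ↔ ∀ t ∈ d.traces, t.Within I → t ∈ c.traces := by
  constructor
  · exact fun h t ht hI => mem_of_mem_wconj_inv (h (mem_wconj_inv_of_within ht hI)) hI.first_mem
  · intro h t ht
    by_cases hI : t.first ∈ I
    · refine mem_of_mem_ofTraces (P := fun t => t.first ∈ I) (prefixClosed_wconjTraces _ _)
        (fun t σ s h he => he.first_eq ▸ h) ?_ ht hI
      rintro t (⟨hi, hd⟩ | ⟨σ, s, rfl, ⟨hi, -⟩ | ⟨hi, hd⟩⟩) hI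
      · have hw := (within_of_mem_inv hi hI).1
        exact mem_wconj_inv_of_within (h t hd hw) hw
      · exact absurd rfl ((within_of_mem_inv hi hI).2 σ s)
      · have hw : (Trace.fin σ s .aborted).Within I := (within_of_mem_inv hi hI).1
        exact mem_wconj_inv_of_within (h _ hd hw) hw
    · exact mem_wconj_inv_of_first_notMem c hI

theorem Reifies.refl (I : Set S) (c : Command S) : Reifies I c c := le_refl (wconj (inv I) c)

theorem reifies_ofTraces {I : Set S} {c : Command S} {T : Set (Trace S)} (hT : PrefixClosed T)
    (h : ∀ t ∈ T, t.Within I → t ∈ c.traces) : Reifies I c (ofTraces T) :=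
  reifies_iff.2 fun _ ht hI =>
    mem_of_mem_ofTraces hT (fun _ _ _ h he => h.of_extends he _) h ht hI

theorem Reifies.sSup {I : Set S} {C D : Set (Command S)}
    (h : ∀ d ∈ D, ∃ c ∈ C, Reifies I c d) : Reifies I (sSup C) (sSup D) := by
  refine reifies_iff.2 ?_
  rintro t (⟨σ, rfl⟩ | ⟨d, hd, ht⟩) hI
  · exact Command.start _ σ
  · obtain ⟨c, hc, hcd⟩ := h d hd
    exact Or.inr ⟨c, hc, reifies_iff.1 hcd t ht hI⟩

section Binary

variable {I : Set S} {c₁ c₂ d₁ d₂ : Command S}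

theorem Reifies.sup (h₁ : Reifies I c₁ d₁) (h₂ : Reifies I c₂ d₂) :
    Reifies I (c₁ ⊔ c₂) (d₁ ⊔ d₂) :=
  reifies_iff.2 fun t ht hI =>
    ht.imp (fun h => reifies_iff.1 h₁ t h hI) (fun h => reifies_iff.1 h₂ t h hI)

theorem Reifies.seq (h₁ : Reifies I c₁ d₁) (h₂ : Reifies I c₂ d₂) :
    Reifies I (seq c₁ c₂) (seq d₁ d₂) := by
  rw [reifies_iff] at h₁ h₂
  refine reifies_ofTraces (prefixClosed_seqTraces d₁ d₂) ?_
  rintro t (⟨ht, hn⟩ | ⟨σ, s, t', ht, ht', hf, rfl⟩) hI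
  · exact Or.inl (Or.inl ⟨h₁ t ht hI, hn⟩)
  · obtain ⟨hs, hI'⟩ := Trace.within_prepend hI hf
    exact Or.inl (Or.inr ⟨σ, s, t', h₁ _ ht (hs _), h₂ t' ht' hI', hf, rfl⟩)

theorem Reifies.wconj (h₁ : Reifies I c₁ d₁) (h₂ : Reifies I c₂ d₂) :
    Reifies I (wconj c₁ c₂) (wconj d₁ d₂) := by
  rw [reifies_iff] at h₁ h₂
  refine reifies_ofTraces (prefixClosed_wconjTraces d₁ d₂) ?_
  rintro t (⟨ht₁, ht₂⟩ | ⟨σ, s, rfl, ⟨ht₁, ht₂⟩ | ⟨ht₁, ht₂⟩⟩) hI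
  · exact Or.inl (Or.inl ⟨h₁ t ht₁ hI, h₂ t ht₂ hI⟩)
  · exact Or.inl (Or.inr ⟨σ, s, rfl, Or.inl ⟨h₁ _ ht₁ hI, h₂ _ ht₂ hI⟩⟩)
  · exact Or.inl (Or.inr ⟨σ, s, rfl, Or.inr ⟨h₁ _ ht₁ hI, h₂ _ ht₂ hI⟩⟩)

theorem Reifies.par (h₁ : Reifies I c₁ d₁) (h₂ : Reifies I c₂ d₂) :
    Reifies I (par c₁ c₂) (par d₁ d₂) := by
  rw [reifies_iff] at h₁ h₂
  refine reifies_ofTraces (prefixClosed_parTraces d₁ d₂) fun t ht hI => subset_ofTraces _ ?_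
  rcases ht with (⟨σ, s₁, s₂, s, e, he, h, hc, hd, rfl⟩ | ⟨σ, f₁, f₂, f, h, hc, hd, rfl⟩) |
    ⟨σ, s₁, s₂, s, h, rfl, ⟨hc, hd⟩ | ⟨hc, hd⟩⟩
  · obtain ⟨hs₁, hs₂⟩ := h.states_mem hI.2
    exact Or.inl (Or.inl ⟨σ, s₁, s₂, s, e, he, h, h₁ _ hc ⟨hI.1, hs₁⟩, h₂ _ hd ⟨hI.1, hs₂⟩, rfl⟩)
  · exact Or.inl (Or.inr ⟨σ, f₁, f₂, f, h, h₁ _ hc ⟨hI.1, fun n => (h n).2.1 ▸ hI.2 n⟩,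
      h₂ _ hd ⟨hI.1, fun n => (h n).2.2 ▸ hI.2 n⟩, rfl⟩)
  · obtain ⟨hs₁, hs₂⟩ := h.states_mem hI.2
    exact Or.inr ⟨σ, s₁, s₂, s, h, rfl, Or.inl ⟨h₁ _ hc ⟨hI.1, hs₁⟩, h₂ _ hd ⟨hI.1, hs₂⟩⟩⟩
  · obtain ⟨hs₁, hs₂⟩ := h.states_mem hI.2
    exact Or.inr ⟨σ, s₁, s₂, s, h, rfl, Or.inr ⟨h₁ _ hc ⟨hI.1, hs₁⟩, h₂ _ hd ⟨hI.1, hs₂⟩⟩⟩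

end Binary

section Iteration

variable {I : Set S} {c d : Command S}

theorem Reifies.unfold (h : Reifies I c d) {x y : Command S} (hxy : Reifies I x y) :
    Reifies I (unfold c x) (unfold d y) :=
  (Reifies.refl I nil).sup (h.seq hxy)

theorem Reifies.finIter (h : Reifies I c d) : Reifies I (finIter c) (finIter d) := by
  let q : Command S := SupSet.sSup {y | Reifies I (Command.finIter c) y}
  have hq : Reifies I (Command.finIter c) q := by
    have := Reifies.sSup (I := I) (C := {Command.finIter c})
      (D := {y | Reifies I (Command.finIter c) y}) fun y hy => ⟨_, rfl, hy⟩
    rwa [sSup_singleton] at this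
  have hle : Command.finIter d ≤ q := by
    refine OrderHom.lfp_le _ (le_sSup ?_)
    have := h.unfold hq
    rwa [Command.finIter, OrderHom.map_lfp] at this
  exact reifies_iff.2 fun t ht hI => reifies_iff.1 hq t (hle ht) hI

theorem Reifies.omIter (h : Reifies I c d) : Reifies I (omIter c) (omIter d) := by
  let a : Command S := ofTraces {t | t ∈ (Command.omIter d).traces ∧ t.Within I}
  have ha : Reifies I a (Command.omIter d) :=
    reifies_iff.2 fun t ht hI => subset_ofTraces _ ⟨ht, hI⟩
  have hle : a ≤ Command.omIter c := by
    refine OrderHom.le_gfp _ (ofTraces_le.2 fun t ht => ?_)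
    have := h.unfold ha
    rw [Command.omIter, OrderHom.map_gfp] at this
    exact reifies_iff.1 this t ht.1 ht.2
  exact reifies_iff.2 fun t ht hI => hle (reifies_iff.1 ha t ht hI)

end Iteration

end Command

end RG

theorem mainTheorem3 {S : Type*} (I : Set S) :
    (∀ C D : Set (RG.Command S),
      (∀ d ∈ D, ∃ c ∈ C, RG.Command.Reifies I c d) →
        RG.Command.Reifies I (sSup C) (sSup D)) ∧
    (∀ c₁ c₂ d₁ d₂ : RG.Command S,
      RG.Command.Reifies I c₁ d₁ → RG.Command.Reifies I c₂ d₂ →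
        RG.Command.Reifies I (c₁ ⊔ c₂) (d₁ ⊔ d₂)) ∧
    (∀ c₁ c₂ d₁ d₂ : RG.Command S,
      RG.Command.Reifies I c₁ d₁ → RG.Command.Reifies I c₂ d₂ →
        RG.Command.Reifies I (RG.Command.seq c₁ c₂) (RG.Command.seq d₁ d₂)) ∧
    (∀ c₁ c₂ d₁ d₂ : RG.Command S,
      RG.Command.Reifies I c₁ d₁ → RG.Command.Reifies I c₂ d₂ →
        RG.Command.Reifies I (RG.Command.par c₁ c₂) (RG.Command.par d₁ d₂)) ∧
    (∀ c₁ c₂ d₁ d₂ : RG.Command S,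
      RG.Command.Reifies I c₁ d₁ → RG.Command.Reifies I c₂ d₂ →
        RG.Command.Reifies I (RG.Command.wconj c₁ c₂) (RG.Command.wconj d₁ d₂)) ∧
    (∀ c d : RG.Command S,
      RG.Command.Reifies I c d →
        RG.Command.Reifies I (RG.Command.finIter c) (RG.Command.finIter d)) ∧
    (∀ c d : RG.Command S,
      RG.Command.Reifies I c d →
        RG.Command.Reifies I (RG.Command.omIter c) (RG.Command.omIter d)) :=
  ⟨fun _ _ h => .sSup h, fun _ _ _ _ h₁ h₂ => .sup h₁ h₂, fun _ _ _ _ h₁ h₂ => .seq h₁ h₂,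
    fun _ _ _ _ h₁ h₂ => .par h₁ h₂, fun _ _ _ _ h₁ h₂ => .wconj h₁ h₂,
    fun _ _ h => .finIter h, fun _ _ h => .omIter h⟩
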